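/- **Setting.** Let $N\ge 1$, $l\ge 0$, and let $L(x)=\sum_{d\ge1}L_dx^d$, $R(x)=\sum_{d\ge1}R_dx^d$ be degree distributions (nonnegative coefficients summing to $1$). The ensemble $\mathrm{LDPC}(N,L,R)$, assumed nonempty, is the set of all bipartite (Tanner) graphs $G$ without parallel edges on $N$ variable nodes and $M=N L'(1)/R'(1)$ check nodes in which, for every $d$, a proportion $L_d$ of the variable nodes and a proportion $R_d$ of the check nodes have degree $d$; $G$ is drawn uniformly from it. The code of $G$ consists of the words $x\in\{0,1\}^N$ such that the bits at the neighbours of each check node have even sum. For a variable node $v$ and even $k$, the computation graph $T_k(v,G)$ is the tree of height $k$ rooted at a copy of $v$, in which the children of a copy of a node $u$ at a level below $k$ are copies of the neighbours of $u$ in $G$ except the one whose copy is its parent. The root-constrained tree code $\mathcal C^1_k(v,G)$ is the set of $0/1$ assignments to the distinct variable nodes occurring in $T_k(v,G)$ (all copies of a node carry the same bit) that satisfy every check node occurring in $T_k(v,G)$ and give $v$ the value $1$. Let $w^1_k(v,G)$ be the minimum Hamming weight in $\mathcal C^1_k(v,G)$ (number of distinct variable nodes with value $1$; $\infty$ if this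 code is empty), and let $\overline w^1_k(N,L,R)$ be the expectation of $w^1_k(v,G)$ for $G$ uniform in $\mathrm{LDPC}(N,L,R)$ and $v$ a uniform variable node of $G$. A codeword of $G$ is sent through a binary-input memoryless channel and $l$ iterations of flooding belief propagation (BP) are performed with messages in $[-\infty,\infty]$: with $\mathrm{LLR}_i=\ln\frac{p(y_i|0)}{p(y_i|1)}$ and $B^{(0)}_{c\to v}=0$, $$B^{(t)}_{v_i\to c}=\mathrm{LLR}_i+\sum_{a\in\mathcal N(v_i)\setminus c}B^{(t-1)}_{a\to v_i},\qquad B^{(t)}_{c\to v}=2\tanh^{-1}\Big(\prod_{b\in\mathcal N(c)\setminus v}\tanh\frac{B^{(t)}_{b\to c}}2\Big),\qquad B^{(l)}_{v_i}=\mathrm{LLR}_i+\sum_{a\in\mathcal N(v_i)}B^{(l)}_{a\to v_i}.$$ A positive output decides for $0$, a negative one for $1$. An output equal to $0$ is undecided; it counts as an error on the BEC, and as an error with any fixed weight $\tau\in[\frac12,1]$ on the other two channels ($\tau=\frac12$: fair coin; $\tau=1$: error). The average BER $\overline P_e$ is the error probability of a uniform variable node of a uniform $G\in\mathrm{LDPC}(N,L,R)$,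 averaged also over the transmitted codeword, which may be drawn from any distribution on the code of $G$ (for instance the all-zero word, or the uniform distribution). **Theorem 1.** If $\overline w^1_{2l}(N,L,R)=w<\infty$, then $$\overline P_e\ \ge\ Q\!\left(\sqrt{w/\sigma^2}\right)$$ for the BI-AWGN channel (inputs $\pm1$, noise variance $\sigma^2>0$), $$\overline P_e\ \ge\ q^{(w+1)/2}$$ for the BSC with crossover probability $0\le q\le\frac12$, and $$\overline P_e\ \ge\ \epsilon^{w}$$ for the BEC with erasure probability $0\le\epsilon\le1$. Here $Q(x)=\int_x^\infty\frac1{\sqrt{2\pi}}e^{-t^2/2}\,dt$. -/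

import Mathlib

open scoped ENNReal NNReal Polynomial

namespace LDPC

noncomputable section

/-! ### Tanner graphs, codes and the ensemble -/

/-- A Tanner graph without parallel edges on the variable nodes `Fin N` and the check nodes
`Fin M`, given by its parity-check matrix: `v` and `c` are adjacent iff `H c v = 1`. -/
abbrev TannerGraph (M N : ℕ) : Type := Matrix (Fin M) (Fin N) (ZMod 2)

variable {M N : ℕ}

/-- Variable nodes adjacent to the check node `c`. -/
def checkNbrs (H : TannerGraph M N) (c : Fin M) : Finset (Fin N) :=
  Finset.univ.filter fun v => H c v = 1

/-- Check nodes adjacent to the variable node `v`. -/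
def varNbrs (H : TannerGraph M N) (v : Fin N) : Finset (Fin M) :=
  Finset.univ.filter fun c => H c v = 1

/-- The linear code with parity-check matrix `H`. -/
def code (H : TannerGraph M N) : Finset (Fin N → ZMod 2) :=
  Finset.univ.filter fun x => H.mulVec x = 0

/-- Degree distributions `∑_{d ≥ 1} P_d x ^ d` from the node perspective; `P_d` is a proportion. -/
def IsDegreeDistribution (P : ℝ[X]) : Prop :=
  P.coeff 0 = 0 ∧ (∀ d, 0 ≤ P.coeff d) ∧ P.eval 1 = 1

/-- The number of check nodes, `N L'(1) / R'(1)`. If this quotient is not an integer, then no graph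
has the required degrees, since the edges seen from the two sides would not match. -/
def numChecks (N : ℕ) (L R : ℝ[X]) : ℕ :=
  ⌊(N : ℝ) * L.derivative.eval 1 / R.derivative.eval 1⌋₊

open Classical in
/-- The graphs of `LDPC(N, L, R)`: all Tanner graphs without parallel edges in which, for every `d`,
a proportion `L_d` of the `N` variable nodes and a proportion `R_d` of the check nodes have
degree `d`. -/
def ensemble (N : ℕ) (L R : ℝ[X]) : Finset (TannerGraph (numChecks N L R) N) :=
  Finset.univ.filter fun H =>
    (∀ d : ℕ, ((Finset.univ.filter fun v => (varNbrs H v).card = d).card : ℝ)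
        = N * L.coeff d) ∧
    (∀ d : ℕ, ((Finset.univ.filter fun c => (checkNbrs H c).card = d).card : ℝ)
        = numChecks N L R * R.coeff d)

/-! ### Computation graphs and tree codes -/

/-- Nodes of the Tanner graph: variable nodes `Sum.inl v` and check nodes `Sum.inr c`. -/
abbrev Node (M N : ℕ) : Type := Fin N ⊕ Fin M

/-- Adjacency in the Tanner graph. -/
def Adj (H : TannerGraph M N) : Node M N → Node M N → Prop
  | Sum.inl v, Sum.inr c => H c v = 1
  | Sum.inr c, Sum.inl v => H c v = 1
  | _, _ => False

/-- The infinite computation tree rooted at the variable node `v`. A node of the tree is the list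
`u :: p`, where `u` is the node of the graph of which it is a copy and `p` is its parent
(`p = []` for the root). The children of `u :: p` are copies of the neighbours of `u` other than
the node of which the parent `p` is a copy. -/
inductive IsTreeNode (H : TannerGraph M N) (v : Fin N) : List (Node M N) → Prop
  | root : IsTreeNode H v [Sum.inl v]
  | child {u u' : Node M N} {p : List (Node M N)} :
      IsTreeNode H v (u :: p) → Adj H u u' → p.head? ≠ some u' → IsTreeNode H v (u' :: u :: p)

/-- The computation graph `T_k(v, G)`: the nodes of the tree at levels `0, …, k`; the level of a
node is the length of its list minus one. -/
def compGraph (H : TannerGraph M N) (k : ℕ) (v : Fin N) : Set (List (Node M N)) :=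
  {t | IsTreeNode H v t ∧ t.length ≤ k + 1}

/-- The node `u` of the Tanner graph has a copy in `T_k(v, G)`. -/
def Occurs (H : TannerGraph M N) (k : ℕ) (v : Fin N) (u : Node M N) : Prop :=
  ∃ p : List (Node M N), u :: p ∈ compGraph H k v

/-- The tree code `C_k(v, G)`, for even `k`. All copies of a variable node carry the same bit, so
an assignment is a word `s` indexed by the distinct variable nodes that occur in `T_k(v, G)`,
extended by zero to the other variable nodes. For even `k` every copy of a check node is at a level
below `k`, so its parent and its children are together exactly one copy of each of its
neighbours. -/
def treeCode (H : TannerGraph M N) (k : ℕ) (v : Fin N) : Set (Fin N → ZMod 2) :=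
  {s | (∀ u, ¬ Occurs H k v (Sum.inl u) → s u = 0) ∧
    ∀ c, Occurs H k v (Sum.inr c) → ∑ u ∈ checkNbrs H c, s u = 0}

/-- The root-constrained tree code `C^1_k(v, G)`. -/
def rootOneTreeCode (H : TannerGraph M N) (k : ℕ) (v : Fin N) : Set (Fin N → ZMod 2) :=
  {s | s ∈ treeCode H k v ∧ s v = 1}

/-- The minimum Hamming weight `w^1_k(v, G)` of `C^1_k(v, G)`; it is `∞` if the code is empty. -/
def minWeight (H : TannerGraph M N) (k : ℕ) (v : Fin N) : ℕ∞ :=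
  ⨅ s ∈ rootOneTreeCode H k v, (hammingNorm s : ℕ∞)

/-- The expectation of `w^1_k(v, G)` for `G` uniform in `LDPC(N, L, R)` and `v` a uniform variable
node. -/
def expectedMinWeight (N : ℕ) (L R : ℝ[X]) (k : ℕ) : ℝ≥0∞ :=
  (∑ H ∈ ensemble N L R, ∑ v : Fin N, (minWeight H k v : ℝ≥0∞)) /
    (((ensemble N L R).card : ℝ≥0∞) * N)

/-! ### Binary-input memoryless channels -/

/-- A binary-input channel with output alphabet `Y`, given by its transition densities
`dens x y = p(y|x)` with respect to a reference measure. -/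
structure BinaryChannel (Y : Type) [MeasurableSpace Y] where
  ref : MeasureTheory.Measure Y
  dens : ZMod 2 → Y → ℝ≥0∞

namespace BinaryChannel

variable {Y : Type} [MeasurableSpace Y]

/-- The law of the output when the bit `x` is sent. -/
def law (W : BinaryChannel Y) (x : ZMod 2) : MeasureTheory.Measure Y :=
  W.ref.withDensity (W.dens x)

/-- The law of the received word when the word `x` is sent through the memoryless channel. -/
def wordLaw (W : BinaryChannel Y) (x : Fin N → ZMod 2) : MeasureTheory.Measure (Fin N → Y) :=
  MeasureTheory.Measure.pi fun i => W.law (x i)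

/-- The log-likelihood ratio `ln (p(y|0) / p(y|1))`. -/
def llr (W : BinaryChannel Y) (y : Y) : EReal :=
  ENNReal.log (W.dens 0 y / W.dens 1 y)

end BinaryChannel

/-- The BI-AWGN channel: `x` is sent as `(-1) ^ x`, and Gaussian noise of variance `σ ^ 2` is
added. -/
def biAWGN (σ : ℝ≥0) : BinaryChannel ℝ where
  ref := MeasureTheory.volume
  dens x := ProbabilityTheory.gaussianPDF ((-1) ^ x.val) (σ ^ 2)

/-- The binary symmetric channel with crossover probability `q`. -/
def bsc (q : ℝ) : BinaryChannel (ZMod 2) where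
  ref := MeasureTheory.Measure.count
  dens x y := if y = x then ENNReal.ofReal (1 - q) else ENNReal.ofReal q

/-- Outputs of the erasure channel: a bit, or the erasure `none`. -/
def ErasedBit : Type := Option (ZMod 2)

instance : MeasurableSpace ErasedBit := ⊤

/-- Transition probabilities of the erasure channel with erasure probability `ε`. -/
def becProb (ε : ℝ) (x : ZMod 2) : Option (ZMod 2) → ℝ≥0∞
  | none => ENNReal.ofReal ε
  | some b => if b = x then ENNReal.ofReal (1 - ε) else 0

/-- The binary erasure channel with erasure probability `ε`. -/
def bec (ε : ℝ) : BinaryChannel ErasedBit where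
  ref := MeasureTheory.Measure.count
  dens x y := becProb ε x y

/-! ### Belief propagation with the flooding schedule -/

/-- `tanh (b / 2)`, with the limits `±1` at `±∞`. -/
def tanhHalf : EReal → ℝ
  | ⊤ => 1
  | ⊥ => -1
  | (b : ℝ) => Real.tanh (b / 2)

/-- `2 artanh t` for `t ∈ [-1, 1]`, with the limits `±∞` at `±1`. -/
def twoArtanh (t : ℝ) : EReal :=
  if 1 ≤ t then ⊤ else if t ≤ -1 then ⊥ else ((2 * Real.artanh t : ℝ) : EReal)

/-- Update of the message from variable node `v` to check node `c`, given the log-likelihood ratios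
`lam` of the channel and the check-to-variable messages `B` of the previous iteration. -/
def varUpdate (H : TannerGraph M N) (lam : Fin N → EReal) (B : Fin M → Fin N → EReal)
    (v : Fin N) (c : Fin M) : EReal :=
  lam v + ∑ a ∈ (varNbrs H v).erase c, B a v

/-- Update of the message from check node `c` to variable node `v`, given the variable-to-check
messages `B` of the same iteration. -/
def checkUpdate (H : TannerGraph M N) (B : Fin N → Fin M → EReal) (c : Fin M) (v : Fin N) :
    EReal :=
  twoArtanh (∏ b ∈ (checkNbrs H c).erase v, tanhHalf (B b c))

/-- Check-to-variable messages of iteration `l`. -/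
def checkMsg (H : TannerGraph M N) (lam : Fin N → EReal) : ℕ → Fin M → Fin N → EReal
  | 0 => fun _ _ => 0
  | l + 1 => checkUpdate H (varUpdate H lam (checkMsg H lam l))

/-- The output of belief propagation at variable node `v` after `l` iterations. -/
def bpOutput (H : TannerGraph M N) (lam : Fin N → EReal) (l : ℕ) (v : Fin N) : EReal :=
  lam v + ∑ a ∈ varNbrs H v, checkMsg H lam l a v

/-- The output `b` decides for the wrong bit: a positive value decides for `0`, a negative one
for `1`. -/
def WrongDecision (b : EReal) (x : ZMod 2) : Prop :=
  (x = 0 ∧ b < 0) ∨ (x = 1 ∧ 0 < b)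

/-! ### Bit error rates -/

variable {Y : Type} [MeasurableSpace Y]

/-- The error probability of variable node `v` after `l` iterations when `x` is sent. The undecided
output `0` counts as an error with weight `τ`: `τ = 1` if an undecided bit (an erasure) is an error,
`τ = 1 / 2` if it is decided by a fair coin. -/
def bitErrorProb (W : BinaryChannel Y) (τ : ℝ) (H : TannerGraph M N) (l : ℕ)
    (x : Fin N → ZMod 2) (v : Fin N) : ℝ :=
  (W.wordLaw x).real {y | WrongDecision (bpOutput H (fun i => W.llr (y i)) l v) (x v)} +
    τ * (W.wordLaw x).real {y | bpOutput H (fun i => W.llr (y i)) l v = 0}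

/-- The average bit error rate of the ensemble under `l` iterations: the graph `H` is uniform in
`LDPC(N, L, R)`, the transmitted codeword of `H` is drawn from `src H`, and the variable node is
uniform. -/
def averageBER (W : BinaryChannel Y) (τ : ℝ) (N : ℕ) (L R : ℝ[X])
    (src : ∀ H : TannerGraph (numChecks N L R) N, PMF {x // x ∈ code H}) (l : ℕ) : ℝ :=
  (∑ H ∈ ensemble N L R, ∑ x : {x // x ∈ code H}, (src H x).toReal *
      ((∑ v : Fin N, bitErrorProb W τ H l x.1 v) / N)) / (ensemble N L R).card

/-- The complementary standard normal distribution function. -/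
def gaussQ (x : ℝ) : ℝ :=
  ∫ t in Set.Ioi x, 1 / √(2 * Real.pi) * Real.exp (-t ^ 2 / 2)

end

end LDPC

/-!
Fix a graph `H`, a variable node `v`, a transmitted word `x` and a word `s` of minimum weight `n` in
the root-constrained tree code `C^1_{2l}(v, H)`. The output of belief propagation at `v` after
`l` iterations is computed from messages along the edges of the computation graph of height `2l`,
and `s` satisfies all check nodes that occur there while `s v = 1`.

*Gaussian and binary symmetric channels.* Negate the channel log-likelihood ratios on the support of
`s`. The messages along the tree then change sign exactly at the nodes of the support
(`checkMsg_flipSign`), so the output at `v` is negated (`bpOutput_flipSign`). The decision at `v` is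
therefore a test between the law of the received word and its reflection on the support of `s`, with
equal error probabilities under the two hypotheses. By a Neyman–Pearson argument
(`measure_le_add_half_of_antisymm`) it errs at least as often as the maximum likelihood test, which
only sees the `n` positions of the support. The error probability of the latter is
`Q(√(n / σ ^ 2))` for Gaussian noise, and at least `q ^ ((n + 1) / 2)` for the binary symmetric
channel. Negation commutes with the addition of messages in `[-∞, ∞]` because, for finite
log-likelihood ratios, no message is `-∞` (`checkMsg_ne_bot`).

*Erasure channel.* If the `n` bits of the support are erased, which has probability `ε ^ n`, then
every check node that sends a message to a node of the support receives `0` from another one, so the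
output at `v` is `0` (`bpOutput_eq_zero`).

The three bounds are convex functions of `n`, and Jensen's inequality passes to the average over the
graphs and the variable nodes (`le_averageBER`). The transmitted word is arbitrary in the bounds, so
its distribution plays no role.
-/

namespace LDPC

open MeasureTheory

/-! ### Words of the tree code seen from the edges of the computation tree -/

/-- The edge from the variable node `u` down to the check node `c` occurs in the infinite
computation tree of `v`, with the copy of `u` at a level at most `2 * (l - t)`. The message from `c`
to `u` that flows up along this edge in iteration `t` is the one on which the output at `v` after
`l` iterations depends. -/
def IsTreeEdge {M N : ℕ} (H : TannerGraph M N) (v : Fin N) (l t : ℕ) (u : Fin N) (c : Fin M) :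
    Prop :=
  ∃ p : List (Node M N), IsTreeNode H v (Sum.inl u :: p) ∧ H c u = 1 ∧
    p.head? ≠ some (Sum.inr c) ∧ p.length + 2 * t ≤ 2 * l

section Tree

variable {M N : ℕ} {H : TannerGraph M N} {v : Fin N} {l t : ℕ}

theorem mem_checkNbrs {c : Fin M} {u : Fin N} : u ∈ checkNbrs H c ↔ H c u = 1 := by
  simp [checkNbrs]

theorem mem_varNbrs {c : Fin M} {u : Fin N} : c ∈ varNbrs H u ↔ H c u = 1 := by
  simp [varNbrs]

theorem isTreeEdge_root {c : Fin M} (hc : c ∈ varNbrs H v) : IsTreeEdge H v l l v c :=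
  ⟨[], .root, mem_varNbrs.1 hc, by simp, by simp⟩

theorem IsTreeEdge.mem_checkNbrs {u : Fin N} {c : Fin M} (h : IsTreeEdge H v l t u c) :
    u ∈ checkNbrs H c := by
  obtain ⟨p, -, h, -⟩ := h
  exact LDPC.mem_checkNbrs.2 h

/-- The message that flows up along an edge in iteration `t + 1` is computed from those that flow up
in iteration `t` along the edges two levels below. -/
theorem IsTreeEdge.step {u b : Fin N} {c a : Fin M} (h : IsTreeEdge H v l (t + 1) u c)
    (hb : b ∈ (checkNbrs H c).erase u) (ha : a ∈ (varNbrs H b).erase c) :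
    IsTreeEdge H v l t b a := by
  obtain ⟨p, hp, hcu, hhead, hlen⟩ := h
  rw [Finset.mem_erase, LDPC.mem_checkNbrs] at hb
  rw [Finset.mem_erase, mem_varNbrs] at ha
  refine ⟨Sum.inr c :: Sum.inl u :: p, .child (.child hp hcu hhead) hb.2 ?_, ha.2, ?_, ?_⟩
  · simpa using fun h => hb.1 h.symm
  · simpa using fun h => ha.1 h.symm
  · simp only [List.length_cons]
    omega

/-- A check node at the lower end of a tree edge is satisfied by the words of the tree code. -/
theorem IsTreeEdge.sum_erase {u : Fin N} {c : Fin M} (h : IsTreeEdge H v l (t + 1) u c)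
    {s : Fin N → ZMod 2} (hs : s ∈ treeCode H (2 * l) v) :
    ∑ b ∈ (checkNbrs H c).erase u, s b = s u := by
  have hu := h.mem_checkNbrs
  obtain ⟨p, hp, hcu, hhead, hlen⟩ := h
  have h0 := hs.2 c ⟨Sum.inl u :: p, .child hp hcu hhead, by
    simp only [List.length_cons]
    omega⟩
  rw [← Finset.add_sum_erase _ _ hu] at h0
  rw [eq_comm]
  exact CharTwo.add_eq_zero.1 h0

end Tree

/-! ### Sign changes of messages -/

theorem zmod_two_cases (b : ZMod 2) : b = 0 ∨ b = 1 := by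
  revert b
  decide

/-- The message `b`, negated if the bit `a` is `1`. -/
noncomputable def flipSign (a : ZMod 2) (b : EReal) : EReal := if a = 1 then -b else b

/-- The sign `(-1) ^ a` of the bit `a`. -/
noncomputable def bitSign (a : ZMod 2) : ℝ := if a = 1 then -1 else 1

theorem bitSign_add (a b : ZMod 2) : bitSign (a + b) = bitSign a * bitSign b := by
  have key : ∀ a b : ZMod 2, a + b = 1 ↔ (a = 1 ∧ b ≠ 1 ∨ a ≠ 1 ∧ b = 1) := by decide
  unfold bitSign
  rw [if_congr (key a b) rfl rfl]
  by_cases ha : a = 1 <;> by_cases hb : b = 1 <;> simp [ha, hb]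

theorem bitSign_sum {ι : Type*} (I : Finset ι) (s : ι → ZMod 2) :
    bitSign (∑ i ∈ I, s i) = ∏ i ∈ I, bitSign (s i) := by
  classical
  induction I using Finset.induction_on with
  | empty => simp [bitSign]
  | insert i I hi ih => rw [Finset.sum_insert hi, Finset.prod_insert hi, bitSign_add, ih]

theorem tanhHalf_top : tanhHalf ⊤ = 1 := rfl

theorem tanhHalf_bot : tanhHalf ⊥ = -1 := rfl

theorem tanhHalf_coe (b : ℝ) : tanhHalf b = Real.tanh (b / 2) := rfl

theorem tanhHalf_neg (b : EReal) : tanhHalf (-b) = -tanhHalf b := by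
  induction b with
  | bot => simp [tanhHalf_top, tanhHalf_bot]
  | top => simp [tanhHalf_top, tanhHalf_bot]
  | coe b => rw [← EReal.coe_neg, tanhHalf_coe, tanhHalf_coe, neg_div, Real.tanh_neg]

theorem tanhHalf_flipSign (a : ZMod 2) (b : EReal) :
    tanhHalf (flipSign a b) = bitSign a * tanhHalf b := by
  unfold flipSign bitSign
  split_ifs
  · rw [tanhHalf_neg, neg_one_mul]
  · rw [one_mul]

theorem artanh_neg (t : ℝ) (h1 : -1 < t) (h2 : t < 1) : Real.artanh (-t) = -Real.artanh t := by
  rw [Real.artanh_eq_half_log ⟨by linarith, by linarith⟩,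
    Real.artanh_eq_half_log ⟨h1.le, h2.le⟩, sub_neg_eq_add, ← sub_eq_add_neg,
    ← inv_div (1 + t), Real.log_inv, mul_neg]

theorem twoArtanh_neg (t : ℝ) : twoArtanh (-t) = -twoArtanh t := by
  unfold twoArtanh
  by_cases h1 : 1 ≤ t
  · rw [if_neg (by linarith), if_pos (by linarith), if_pos h1, EReal.neg_top]
  by_cases h2 : t ≤ -1
  · rw [if_pos (by linarith), if_neg h1, if_pos h2, EReal.neg_bot]
  rw [if_neg (by linarith), if_neg (by linarith), if_neg h1, if_neg h2,
    artanh_neg t (by linarith) (by linarith), mul_neg, EReal.coe_neg]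

theorem twoArtanh_bitSign_mul (a : ZMod 2) (t : ℝ) :
    twoArtanh (bitSign a * t) = flipSign a (twoArtanh t) := by
  unfold flipSign bitSign
  split_ifs
  · rw [neg_one_mul, twoArtanh_neg]
  · rw [one_mul]

theorem twoArtanh_zero : twoArtanh 0 = 0 := by
  rw [twoArtanh, if_neg (by norm_num), if_neg (by norm_num), Real.artanh_zero, mul_zero,
    EReal.coe_zero]

theorem tanhHalf_zero : tanhHalf 0 = 0 := by
  change Real.tanh (0 / 2) = 0
  simp

/-! ### Absence of negatively infinite messages -/

theorem tanhHalf_mem {b : EReal} (hb : b ≠ ⊥) : -1 < tanhHalf b ∧ tanhHalf b ≤ 1 := by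
  induction b with
  | bot => exact absurd rfl hb
  | top => simp [tanhHalf_top]
  | coe b => exact ⟨Real.neg_one_lt_tanh _, (Real.tanh_lt_one _).le⟩

theorem twoArtanh_ne_bot {t : ℝ} (ht : -1 < t) : twoArtanh t ≠ ⊥ := by
  unfold twoArtanh
  rw [if_neg (not_le.2 ht)]
  split_ifs
  · simp
  · exact EReal.coe_ne_bot _

theorem sum_ne_bot {ι : Type*} (I : Finset ι) (f : ι → EReal) (hf : ∀ i ∈ I, f i ≠ ⊥) :
    ∑ i ∈ I, f i ≠ ⊥ :=
  Finset.sum_induction f (· ≠ ⊥) (fun _ _ ha hb => by simp [EReal.add_eq_bot_iff, ha, hb])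
    (by simp) hf

/-- For finite log-likelihood ratios no message of belief propagation is `-∞`. (A check node of
degree one does send `+∞`.) -/
theorem checkMsg_ne_bot {M N : ℕ} (H : TannerGraph M N) {lam : Fin N → EReal}
    (hlam : ∀ i, lam i ≠ ⊥) (t : ℕ) (c : Fin M) (u : Fin N) : checkMsg H lam t c u ≠ ⊥ := by
  induction t generalizing c u with
  | zero => simp [checkMsg]
  | succ t ih =>
    refine twoArtanh_ne_bot (Finset.prod_induction _ (fun r : ℝ => -1 < r ∧ r ≤ 1) ?_
      (by norm_num) fun b _ => tanhHalf_mem ?_).1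
    · rintro a b ⟨ha, ha'⟩ ⟨hb, hb'⟩
      constructor
      · rcases ha'.eq_or_lt with rfl | ha'
        · linarith
        · nlinarith [mul_nonneg (sub_nonneg.2 hb') (by linarith : 0 ≤ a + 1),
            mul_pos (sub_pos.2 ha') (by linarith : 0 < b + 1)]
      · nlinarith [mul_nonneg (sub_nonneg.2 hb') (by linarith : 0 ≤ a + 1),
            mul_nonneg (sub_nonneg.2 ha') (by linarith : 0 ≤ b + 1)]
    · simp only [varUpdate, ne_eq, EReal.add_eq_bot_iff, not_or]
      exact ⟨hlam b, sum_ne_bot _ _ fun a _ => ih a b⟩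

/-! ### Symmetry of belief propagation under words of the tree code -/

/-- If no summand is `-∞`, there is no conflict `∞ - ∞`, and sign changes commute with addition. -/
theorem flipSign_add (a : ZMod 2) {b c : EReal} (hb : b ≠ ⊥) (hc : c ≠ ⊥) :
    flipSign a (b + c) = flipSign a b + flipSign a c := by
  unfold flipSign
  split_ifs
  · rw [EReal.neg_add (.inl hb) (.inr hc), sub_eq_add_neg]
  · rfl

theorem flipSign_sum {ι : Type*} (I : Finset ι) (a : ZMod 2) {f : ι → EReal}
    (hf : ∀ i ∈ I, f i ≠ ⊥) : flipSign a (∑ i ∈ I, f i) = ∑ i ∈ I, flipSign a (f i) := by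
  classical
  induction I using Finset.induction_on with
  | empty => simp [flipSign]
  | insert i I hi ih =>
    rw [Finset.forall_mem_insert] at hf
    rw [Finset.sum_insert hi, Finset.sum_insert hi, flipSign_add a hf.1 (sum_ne_bot _ _ hf.2),
      ih hf.2]

section Symmetry

variable {M N : ℕ} {H : TannerGraph M N} {v : Fin N} {l : ℕ} {s : Fin N → ZMod 2}
  {lam : Fin N → EReal}

/-- Flipping the signs of the channel values on the support of a word of the tree code flips the
messages out of the check nodes accordingly: by the check equations, the signs in each product of
hyperbolic tangents multiply to the sign at the receiving node. -/
theorem checkMsg_flipSign (hs : s ∈ treeCode H (2 * l) v) (hlam : ∀ i, lam i ≠ ⊥) (t : ℕ)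
    (u : Fin N) (c : Fin M) (he : IsTreeEdge H v l t u c) :
    checkMsg H (fun i => flipSign (s i) (lam i)) t c u =
      flipSign (s u) (checkMsg H lam t c u) := by
  induction t generalizing u c with
  | zero => simp [checkMsg, flipSign]
  | succ t ih =>
    have hvar : ∀ b ∈ (checkNbrs H c).erase u,
        varUpdate H (fun i => flipSign (s i) (lam i))
          (checkMsg H (fun i => flipSign (s i) (lam i)) t) b c =
        flipSign (s b) (varUpdate H lam (checkMsg H lam t) b c) := by
      intro b hb
      have hne := fun a (_ : a ∈ (varNbrs H b).erase c) => checkMsg_ne_bot H hlam t a b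
      unfold varUpdate
      rw [flipSign_add _ (hlam b) (sum_ne_bot _ _ hne), flipSign_sum _ _ hne,
        Finset.sum_congr rfl fun a ha => ih b a (he.step hb ha)]
    simp only [checkMsg, checkUpdate]
    rw [Finset.prod_congr rfl fun b hb => by rw [hvar b hb, tanhHalf_flipSign],
      Finset.prod_mul_distrib, ← bitSign_sum, he.sum_erase hs, twoArtanh_bitSign_mul]

/-- Flipping the signs of the channel values on the support of a word of the root-constrained tree
code negates the output at the root. -/
theorem bpOutput_flipSign (hs : s ∈ rootOneTreeCode H (2 * l) v) (hlam : ∀ i, lam i ≠ ⊥) :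
    bpOutput H (fun i => flipSign (s i) (lam i)) l v = -bpOutput H lam l v := by
  have hne := fun a (_ : a ∈ varNbrs H v) => checkMsg_ne_bot H hlam l a v
  have hneg : ∀ b, -b = flipSign (s v) b := fun b => by rw [flipSign, if_pos hs.2]
  unfold bpOutput
  rw [hneg, flipSign_add _ (hlam v) (sum_ne_bot _ _ hne), flipSign_sum _ _ hne,
    Finset.sum_congr rfl fun a ha => checkMsg_flipSign hs.1 hlam l v a (isTreeEdge_root ha)]

/-- If the channel gives no information on the support of a word of the tree code, then the messages
to its nodes are `0`: by its check equation, a check node adjacent to a node of the support has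
another neighbour in the support. No assumption on the other channel values is needed, as one factor
`0` annihilates a product of finite numbers. -/
theorem checkMsg_eq_zero (hs : s ∈ treeCode H (2 * l) v) (h : ∀ i, s i = 1 → lam i = 0) (t : ℕ)
    (u : Fin N) (c : Fin M) (he : IsTreeEdge H v l t u c) (hu : s u = 1) :
    checkMsg H lam t c u = 0 := by
  induction t generalizing u c with
  | zero => rfl
  | succ t ih =>
    obtain ⟨b, hb, hsb⟩ : ∃ b ∈ (checkNbrs H c).erase u, s b ≠ 0 := by
      apply Finset.exists_ne_zero_of_sum_ne_zero
      rw [he.sum_erase hs, hu]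
      exact one_ne_zero
    have hsb1 : s b = 1 := Fin.eq_one_of_ne_zero _ hsb
    have hvar : varUpdate H lam (checkMsg H lam t) b c = 0 := by
      unfold varUpdate
      rw [h b hsb1, zero_add]
      exact Finset.sum_eq_zero fun a ha => ih b a (he.step hb ha) hsb1
    simp only [checkMsg, checkUpdate]
    rw [Finset.prod_eq_zero hb (by rw [hvar, tanhHalf_zero]), twoArtanh_zero]

theorem bpOutput_eq_zero (hs : s ∈ rootOneTreeCode H (2 * l) v) (h : ∀ i, s i = 1 → lam i = 0) :
    bpOutput H lam l v = 0 := by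
  unfold bpOutput
  rw [h v hs.2, zero_add]
  exact Finset.sum_eq_zero fun a ha =>
    checkMsg_eq_zero hs.1 h l v a (isTreeEdge_root ha) hs.2

end Symmetry

/-! ### Measurability of belief propagation -/

theorem measurable_tanhHalf : Measurable tanhHalf := by
  refine EReal.measurable_of_measurable_real ?_
  have h : Continuous fun r : ℝ => Real.tanh (r / 2) := by
    simp_rw [Real.tanh_eq_sinh_div_cosh]
    exact (by fun_prop : Continuous fun r : ℝ => Real.sinh (r / 2)).div (by fun_prop)
      fun r => (Real.cosh_pos _).ne'
  exact h.measurable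

theorem measurable_twoArtanh : Measurable twoArtanh := by
  have h : Measurable Real.artanh := by
    unfold Real.artanh
    fun_prop
  exact Measurable.ite measurableSet_Ici measurable_const
    (Measurable.ite measurableSet_Iic measurable_const
      (measurable_const.mul h).coe_real_ereal)

theorem measurable_checkMsg {M N : ℕ} (H : TannerGraph M N) (t : ℕ) (c : Fin M) (u : Fin N) :
    Measurable fun lam => checkMsg H lam t c u := by
  induction t generalizing c u with
  | zero => exact measurable_const
  | succ t ih =>
    exact measurable_twoArtanh.comp (Finset.measurable_fun_prod _ fun b _ =>
      measurable_tanhHalf.comp ((measurable_pi_apply b).add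
        (Finset.measurable_fun_sum _ fun a _ => ih a b)))

theorem measurable_bpOutput {M N : ℕ} (H : TannerGraph M N) (l : ℕ) (v : Fin N) :
    Measurable fun lam => bpOutput H lam l v :=
  (measurable_pi_apply v).add (Finset.measurable_fun_sum _ fun a _ => measurable_checkMsg H l a v)

/-! ### Products of measures with densities -/

theorem pi_withDensity {ι : Type*} [Fintype ι] {X : ι → Type*} [∀ i, MeasurableSpace (X i)]
    (μ : ∀ i, Measure (X i)) [∀ i, IsProbabilityMeasure (μ i)] {f : ∀ i, X i → ℝ≥0∞}
    (hf : ∀ i, Measurable (f i)) [∀ i, SigmaFinite ((μ i).withDensity (f i))] :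
    Measure.pi (fun i => (μ i).withDensity (f i)) =
      (Measure.pi μ).withDensity fun y => ∏ i, f i (y i) := by
  refine Measure.pi_eq fun s hs => ?_
  have hind : ∀ y : ∀ i, X i, (Set.univ.pi s).indicator (fun y => ∏ i, f i (y i)) y =
      ∏ i, (s i).indicator (f i) (y i) := by
    intro y
    by_cases hy : y ∈ Set.univ.pi s
    · rw [Set.indicator_of_mem hy]
      exact Finset.prod_congr rfl fun i _ => (Set.indicator_of_mem (hy i trivial) _).symm
    · rw [Set.indicator_of_notMem hy]
      simp only [Set.mem_univ_pi, not_forall] at hy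
      obtain ⟨i, hi⟩ := hy
      exact (Finset.prod_eq_zero (Finset.mem_univ i) (Set.indicator_of_notMem hi _)).symm
  have hm : ∀ i, Measurable ((s i).indicator (f i)) := fun i => (hf i).indicator (hs i)
  rw [withDensity_apply _ (MeasurableSet.univ_pi hs),
    ← lintegral_indicator (MeasurableSet.univ_pi hs), lintegral_congr hind,
    ProbabilityTheory.lintegral_prod_eq_prod_lintegral_of_indepFun _
      (fun i (y : ∀ i, X i) => (s i).indicator (f i) (y i))
      (ProbabilityTheory.iIndepFun_pi fun i => (hm i).aemeasurable)
      fun i => (hm i).comp (measurable_pi_apply i)]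
  refine Finset.prod_congr rfl fun i _ => ?_
  rw [(measurePreserving_eval μ i).lintegral_comp (hm i), lintegral_indicator (hs i),
    withDensity_apply _ (hs i)]

/-! ### A lower bound for antisymmetric tests -/

/-- A form of the Neyman–Pearson lemma. Let `T` transport the hypothesis `μ` to an alternative that
is at most as likely as `μ` outside `U`, so that the test with rejection region `U` is optimal up to
ties. A decision rule rejects `μ` on `A`, accepts it on `C` and is undecided on `Z`, and `T`
exchanges acceptance and rejection. Then its error probability, where ties count half, is at least
`μ U`. -/
theorem measure_le_add_half_of_antisymm {Ω : Type*} [MeasurableSpace Ω] (μ : Measure Ω)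
    [IsFiniteMeasure μ] {T : Ω → Ω} {U A Z C : Set Ω} (hU : MeasurableSet U)
    (hA : MeasurableSet A) (hZ : MeasurableSet Z) (hcover : ∀ y, y ∈ A ∨ y ∈ Z ∨ y ∈ C)
    (hTU : ∀ y ∈ U, T y ∉ U) (hTC : ∀ y ∈ C, T y ∈ A) (hTZ : ∀ y ∈ Z, T y ∈ Z)
    (hle : ∀ B, MeasurableSet B → B ⊆ Uᶜ → μ (T ⁻¹' B) ≤ μ B) :
    μ.real U ≤ μ.real A + 1 / 2 * μ.real Z := by
  have hle' : ∀ B, MeasurableSet B → ∀ D ⊆ U, (∀ y ∈ D, T y ∈ B) →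
      μ.real D ≤ μ.real (B \ U) := by
    intro B hB D hD hDB
    refine (measureReal_mono fun y hy => ?_).trans
      (ENNReal.toReal_mono (measure_ne_top _ _) (hle (B \ U) (hB.diff hU) fun y hy => hy.2))
    exact ⟨hDB y hy, hTU y (hD hy)⟩
  have hC := hle' A hA (U ∩ C) Set.inter_subset_left fun y hy => hTC y hy.2
  have hZ' := hle' Z hZ (Z ∩ U) Set.inter_subset_right fun y hy => hTZ y hy.1
  have hsplitA := measureReal_inter_add_sdiff (μ := μ) (s := A) hU
  have hsplitZ := measureReal_inter_add_sdiff (μ := μ) (s := Z) hU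
  have hUle : μ.real U ≤ μ.real (A ∩ U) + μ.real (Z ∩ U) + μ.real (U ∩ C) := by
    refine (measureReal_mono (s₂ := (A ∩ U) ∪ (Z ∩ U) ∪ (U ∩ C)) fun y hy => ?_).trans
      ((measureReal_union_le _ _).trans (add_le_add_left (measureReal_union_le _ _) _))
    rcases hcover y with h | h | h
    · exact .inl (.inl ⟨h, hy⟩)
    · exact .inl (.inr ⟨h, hy⟩)
    · exact .inr ⟨hy, h⟩
  linarith

/-! ### The error probability over a symmetric channel -/

/-- The channel is symmetric under the measurable map `J` of its outputs, it never reveals the input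
with certainty, and `t b` is a log-likelihood ratio in favour of the input `b`: after `J`, the
outputs for the input `b` have density `exp (-t b)` with respect to those before. -/
structure IsSymmetric {Y : Type} [MeasurableSpace Y] (W : BinaryChannel Y) (J : Y → Y)
    (t : ZMod 2 → Y → ℝ) : Prop where
  isProbabilityMeasure : ∀ b, IsProbabilityMeasure (W.law b)
  measurable_map : Measurable J
  measurable_llr : Measurable W.llr
  measurable_ratio : ∀ b, Measurable (t b)
  dens_map : ∀ b y, W.dens b (J y) = W.dens (b + 1) y
  dens_ne_zero : ∀ b y, W.dens b y ≠ 0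
  dens_ne_top : ∀ b y, W.dens b y ≠ ∞
  map_law : ∀ b, (W.law b).map J =
    (W.law b).withDensity fun y => ENNReal.ofReal (Real.exp (-t b y))

section Symmetric

variable {Y : Type} [MeasurableSpace Y] {W : BinaryChannel Y} {J : Y → Y} {t : ZMod 2 → Y → ℝ}

theorem IsSymmetric.llr_map (h : IsSymmetric W J t) (y : Y) : W.llr (J y) = -W.llr y := by
  have h0 := h.dens_map 0 y
  have h1 := h.dens_map 1 y
  rw [zero_add] at h0
  rw [CharTwo.add_self_eq_zero] at h1
  unfold BinaryChannel.llr
  rw [h0, h1, ← ENNReal.log_inv, ENNReal.inv_div (.inl (h.dens_ne_top _ _))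
    (.inl (h.dens_ne_zero _ _))]

theorem IsSymmetric.llr_ne_bot (h : IsSymmetric W J t) (y : Y) : W.llr y ≠ ⊥ := by
  unfold BinaryChannel.llr
  rw [ne_eq, ENNReal.log_eq_bot_iff, ENNReal.div_eq_zero_iff, not_or]
  exact ⟨h.dens_ne_zero _ _, h.dens_ne_top _ _⟩

/-- Reflection of the received word on the support of `s`. -/
def reflect {N : ℕ} (J : Y → Y) (s : Fin N → ZMod 2) (y : Fin N → Y) : Fin N → Y :=
  fun i => if s i = 1 then J (y i) else y i

/-- Reflection of the received word on the support of `s` yields the law with density `∏ exp (-t)`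
over the support, which is at most `1` wherever the log-likelihood ratio of the two hypotheses is
nonnegative. -/
theorem IsSymmetric.wordLaw_preimage_le {N : ℕ} (h : IsSymmetric W J t) (x s : Fin N → ZMod 2)
    {B : Set (Fin N → Y)} (hB : MeasurableSet B)
    (hpos : ∀ y ∈ B, 0 ≤ ∑ i with s i = 1, t (x i) (y i)) :
    W.wordLaw x (reflect J s ⁻¹' B) ≤ W.wordLaw x B := by
  have := h.isProbabilityMeasure
  let T : Fin N → Y → Y := fun i y => if s i = 1 then J y else y
  let f : Fin N → Y → ℝ≥0∞ :=
    fun i y => if s i = 1 then ENNReal.ofReal (Real.exp (-t (x i) y)) else 1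
  have hT : ∀ i, Measurable (T i) := by
    intro i
    by_cases hi : s i = 1
    · simpa [T, hi] using h.measurable_map
    · simpa [T, hi] using measurable_id'
  have hf : ∀ i, Measurable (f i) := by
    intro i
    by_cases hi : s i = 1
    · simpa [f, hi] using (h.measurable_ratio (x i)).neg.exp.ennreal_ofReal
    · simp [f, hi]
  have hmap : ∀ i, (W.law (x i)).map (T i) = (W.law (x i)).withDensity (f i) := by
    intro i
    by_cases hi : s i = 1
    · simpa [T, f, hi] using h.map_law (x i)
    · simp only [T, f, hi, if_false]
      rw [← Pi.one_def, withDensity_one]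
      exact Measure.map_id
  have hprob : ∀ i, IsProbabilityMeasure ((W.law (x i)).map (T i)) :=
    fun i => Measure.isProbabilityMeasure_map (hT i).aemeasurable
  have hsf : ∀ i, SigmaFinite ((W.law (x i)).withDensity (f i)) := fun i =>
    hmap i ▸ inferInstance
  have hR : Measurable (reflect J s) :=
    measurable_pi_lambda _ fun i => (hT i).comp (measurable_pi_apply i)
  have hlaw : (W.wordLaw x).map (reflect J s) =
      (W.wordLaw x).withDensity fun y => ∏ i, f i (y i) := by
    unfold BinaryChannel.wordLaw
    rw [← pi_withDensity _ hf]
    simp_rw [← hmap]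
    exact Measure.pi_map_pi fun i => (hT i).aemeasurable
  rw [← Measure.map_apply hR hB, hlaw, withDensity_apply _ hB]
  refine (setLIntegral_mono measurable_const fun y hy => ?_).trans_eq (setLIntegral_one B)
  simp only [f]
  rw [← Finset.prod_filter, ← ENNReal.ofReal_prod_of_nonneg fun i _ => (Real.exp_pos _).le,
    ← Real.exp_sum, ENNReal.ofReal_le_one, Real.exp_le_one_iff, Finset.sum_neg_distrib]
  exact neg_nonpos.2 (hpos y hy)

/-- A word `s` of the root-constrained tree code makes the decision at the root a test between the
transmitted word and its reflection on the support of `s`. -/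
theorem IsSymmetric.measure_le_bitErrorProb {M N : ℕ} (h : IsSymmetric W J t)
    {H : TannerGraph M N} {l : ℕ} {v : Fin N} {s : Fin N → ZMod 2}
    (hs : s ∈ rootOneTreeCode H (2 * l) v) (x : Fin N → ZMod 2) {τ : ℝ} (hτ : 1 / 2 ≤ τ)
    {U : Set (Fin N → Y)} (hU : MeasurableSet U) (hTU : ∀ y ∈ U, reflect J s y ∉ U)
    (hpos : ∀ y ∉ U, 0 ≤ ∑ i with s i = 1, t (x i) (y i)) :
    (W.wordLaw x).real U ≤ bitErrorProb W τ H l x v := by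
  have := h.isProbabilityMeasure
  have hfin : IsFiniteMeasure (W.wordLaw x) := by
    unfold BinaryChannel.wordLaw
    infer_instance
  set F : (Fin N → Y) → EReal := fun y => bpOutput H (fun i => W.llr (y i)) l v with hF
  have hFm : Measurable F := (measurable_bpOutput H l v).comp
    (measurable_pi_lambda _ fun i => h.measurable_llr.comp (measurable_pi_apply i))
  have hFT : ∀ y, F (reflect J s y) = -F y := by
    intro y
    rw [hF]
    dsimp only
    rw [← bpOutput_flipSign hs fun i => h.llr_ne_bot (y i)]
    congr 1
    ext i
    unfold reflect flipSign
    split_ifs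
    · exact h.llr_map (y i)
    · rfl
  have hx := zmod_two_cases (x v)
  have hA : MeasurableSet {y | WrongDecision (F y) (x v)} := by
    rcases hx with hx | hx
    · simpa [WrongDecision, hx] using measurableSet_lt hFm measurable_const
    · simpa [WrongDecision, hx] using measurableSet_lt measurable_const hFm
  have hZ : MeasurableSet {y | F y = 0} := hFm (measurableSet_singleton 0)
  refine (measure_le_add_half_of_antisymm (W.wordLaw x) (T := reflect J s)
    (C := {y | WrongDecision (-F y) (x v)}) hU hA hZ ?_ hTU ?_ ?_ ?_).trans
    (add_le_add_right (mul_le_mul_of_nonneg_right hτ measureReal_nonneg) _)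
  · intro y
    rcases hx with hx | hx <;> rcases lt_trichotomy (F y) 0 with hy | hy | hy <;>
      simp [WrongDecision, hx, hy]
  · intro y hy
    simpa [hFT] using hy
  · intro y (hy : F y = 0)
    simp [hFT, hy]
  · exact fun B hB hBU => h.wordLaw_preimage_le x s hB fun y hy => hpos y (hBU hy)

end Symmetric

/-! ### The Gaussian channel -/

theorem gaussQ_eq_measureReal (x : ℝ) :
    gaussQ x = (ProbabilityTheory.gaussianReal 0 1).real (Set.Ioi x) := by
  rw [Measure.real, ProbabilityTheory.gaussianReal_apply_eq_integral 0 one_ne_zero,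
    ENNReal.toReal_ofReal (integral_nonneg fun t => ProbabilityTheory.gaussianPDFReal_nonneg _ _ _)]
  simp [gaussQ, ProbabilityTheory.gaussianPDFReal]

/-- A Gaussian variable of mean `2 * a` and standard deviation `2 * √a` is the image of a standard
one under `t ↦ 2 * a - 2 * √a * t`. -/
theorem gaussianReal_Iio_zero {a : ℝ≥0} (ha : 0 < a) :
    (ProbabilityTheory.gaussianReal (2 * a) (4 * a)).real (Set.Iio 0) = gaussQ (√a) := by
  have ha' : (0 : ℝ) < √a := Real.sqrt_pos.2 ha
  have hsq : √(a : ℝ) * √a = a := Real.mul_self_sqrt a.2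
  have hmap : (ProbabilityTheory.gaussianReal 0 1).map (fun t => 2 * (a : ℝ) - 2 * √a * t) =
      ProbabilityTheory.gaussianReal (2 * a) (4 * a) := by
    rw [← Function.comp_def (fun t => 2 * (a : ℝ) - t) (fun t => 2 * √a * t),
      ← Measure.map_map (by fun_prop) (by fun_prop), ProbabilityTheory.gaussianReal_map_const_mul,
      ProbabilityTheory.gaussianReal_map_const_sub]
    congr 1
    · simp
    · ext
      push_cast
      rw [mul_one, mul_pow, pow_two (√(a : ℝ)), hsq]
      norm_num
  rw [gaussQ_eq_measureReal, ← hmap, map_measureReal_apply (by fun_prop) measurableSet_Iio]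
  congr 1
  ext t
  simp only [Set.mem_preimage, Set.mem_Iio, Set.mem_Ioi, sub_neg]
  constructor <;> intro h <;> nlinarith

theorem map_sum_gaussianReal {ι Ω : Type*} [MeasurableSpace Ω] {P : Measure Ω}
    [IsProbabilityMeasure P] {X : ι → Ω → ℝ} (hind : ProbabilityTheory.iIndepFun X P)
    (hX : ∀ i, Measurable (X i)) {m : ℝ} {v : ℝ≥0}
    (hlaw : ∀ i, P.map (X i) = ProbabilityTheory.gaussianReal m v) (I : Finset ι) :
    P.map (∑ i ∈ I, X i) = ProbabilityTheory.gaussianReal (I.card * m) (I.card * v) := by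
  classical
  induction I using Finset.induction_on with
  | empty =>
    simp only [Finset.sum_empty, Finset.card_empty, Nat.cast_zero, zero_mul,
      ProbabilityTheory.gaussianReal_zero_var]
    rw [Pi.zero_def, Measure.map_const, measure_univ, one_smul]
  | insert i I hi ih =>
    rw [Finset.sum_insert hi, Finset.card_insert_of_notMem hi, add_comm (X i),
      ProbabilityTheory.gaussianReal_add_gaussianReal_of_indepFun
        (hind.indepFun_finsetSum_of_notMem hX hi) ih (hlaw i)]
    congr 1 <;> push_cast <;> ring

/-- The signal for the bit `b`. -/
def signal (b : ZMod 2) : ℝ := (-1) ^ b.val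

theorem signal_sq (b : ZMod 2) : signal b ^ 2 = 1 := by
  rw [signal, ← pow_mul, mul_comm, pow_mul, neg_one_sq, one_pow]

theorem signal_add_one (b : ZMod 2) : signal (b + 1) = -signal b := by
  have h : ∀ b : ZMod 2, b = 0 ∧ b + 1 = 1 ∨ b = 1 ∧ b + 1 = 0 := by decide
  rcases h b with ⟨h1, h2⟩ | ⟨h1, h2⟩ <;> rw [h2, h1] <;> simp [signal, ZMod.val_one]

theorem biAWGN_law {σ : ℝ≥0} (hσ : 0 < σ) (b : ZMod 2) :
    (biAWGN σ).law b = ProbabilityTheory.gaussianReal (signal b) (σ ^ 2) :=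
  (ProbabilityTheory.gaussianReal_of_var_ne_zero _ (pow_pos hσ 2).ne').symm

theorem isSymmetric_biAWGN {σ : ℝ≥0} (hσ : 0 < σ) :
    IsSymmetric (biAWGN σ) (fun y => -y) (fun b y => 2 * signal b / σ ^ 2 * y) where
  isProbabilityMeasure b := by
    rw [biAWGN_law hσ]
    infer_instance
  measurable_map := measurable_neg
  measurable_llr := ENNReal.measurable_log.comp
    ((ProbabilityTheory.measurable_gaussianPDF _ _).div
      (ProbabilityTheory.measurable_gaussianPDF _ _))
  measurable_ratio b := measurable_const.mul measurable_id
  dens_map b y := by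
    change ProbabilityTheory.gaussianPDF (signal b) _ _ =
      ProbabilityTheory.gaussianPDF (signal (b + 1)) _ _
    rw [signal_add_one, ProbabilityTheory.gaussianPDF, ProbabilityTheory.gaussianPDF,
      ProbabilityTheory.gaussianPDFReal, ProbabilityTheory.gaussianPDFReal]
    ring_nf
  dens_ne_zero b y := (ProbabilityTheory.gaussianPDF_pos _ (pow_pos hσ 2).ne' _).ne'
  dens_ne_top b y := ENNReal.ofReal_ne_top
  map_law b := by
    have hσ' : (σ : ℝ) ≠ 0 := NNReal.coe_ne_zero.2 hσ.ne'
    have hm : Measurable fun y : ℝ =>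
        ENNReal.ofReal (Real.exp (-(2 * signal b / (σ : ℝ) ^ 2 * y))) := by fun_prop
    rw [biAWGN_law hσ, ProbabilityTheory.gaussianReal_map_neg,
      ProbabilityTheory.gaussianReal_of_var_ne_zero _ (pow_pos hσ 2).ne',
      ProbabilityTheory.gaussianReal_of_var_ne_zero _ (pow_pos hσ 2).ne',
      ← withDensity_mul _ (ProbabilityTheory.measurable_gaussianPDF _ _) hm]
    congr 1
    ext1 y
    rw [Pi.mul_apply, ProbabilityTheory.gaussianPDF, ProbabilityTheory.gaussianPDF,
      ← ENNReal.ofReal_mul (ProbabilityTheory.gaussianPDFReal_nonneg _ _ _),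
      ProbabilityTheory.gaussianPDFReal, ProbabilityTheory.gaussianPDFReal, mul_assoc (√_)⁻¹,
      ← Real.exp_add]
    congr 3
    push_cast
    field_simp
    ring

/-- The log-likelihood ratio of the two hypotheses is a sum of `n` independent Gaussian variables of
mean `2 / σ ^ 2` and variance `4 / σ ^ 2`. The region `U` compared with the decision is the one
where it is negative. -/
theorem gaussQ_le_bitErrorProb {σ : ℝ≥0} (hσ : 0 < σ) {M N : ℕ} {H : TannerGraph M N} {l : ℕ}
    {v : Fin N} {s : Fin N → ZMod 2} (hs : s ∈ rootOneTreeCode H (2 * l) v)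
    (x : Fin N → ZMod 2) {τ : ℝ} (hτ : 1 / 2 ≤ τ) {n : ℕ}
    (hn : (Finset.univ.filter fun i => s i = 1).card = n) :
    gaussQ (√((n : ℝ) / (σ : ℝ) ^ 2)) ≤ bitErrorProb (biAWGN σ) τ H l x v := by
  have hsym := isSymmetric_biAWGN hσ
  have := hsym.isProbabilityMeasure
  have hσ' : (σ : ℝ) ≠ 0 := NNReal.coe_ne_zero.2 hσ.ne'
  let S : Fin N → (Fin N → ℝ) → ℝ := fun i y => 2 * signal (x i) / (σ : ℝ) ^ 2 * y i
  have hS : ∀ i, Measurable (S i) := fun i => measurable_const.mul (measurable_pi_apply i)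
  have hprob : IsProbabilityMeasure ((biAWGN σ).wordLaw x) := by
    unfold BinaryChannel.wordLaw
    infer_instance
  have hlaw : ∀ i, ((biAWGN σ).wordLaw x).map (S i) =
      ProbabilityTheory.gaussianReal (2 / (σ : ℝ) ^ 2) (4 / σ ^ 2) := by
    intro i
    have hcomp : S i = (fun y : ℝ => 2 * signal (x i) / (σ : ℝ) ^ 2 * y) ∘ Function.eval i := rfl
    have hm : Measurable fun y : ℝ => 2 * signal (x i) / (σ : ℝ) ^ 2 * y := by fun_prop
    have he : Measurable (Function.eval i : (Fin N → ℝ) → ℝ) := measurable_pi_apply i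
    rw [hcomp, ← Measure.map_map hm he, BinaryChannel.wordLaw,
      (measurePreserving_eval (fun i => (biAWGN σ).law (x i)) i).map_eq, biAWGN_law hσ,
      ProbabilityTheory.gaussianReal_map_const_mul]
    congr 1
    · rw [div_mul_eq_mul_div, mul_assoc, ← pow_two, signal_sq, mul_one]
    · ext
      push_cast
      rw [div_pow, mul_pow, signal_sq]
      field_simp
      norm_num
  have hind : ProbabilityTheory.iIndepFun S ((biAWGN σ).wordLaw x) :=
    ProbabilityTheory.iIndepFun_pi (X := fun i (y : ℝ) => 2 * signal (x i) / (σ : ℝ) ^ 2 * y)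
      fun i => (measurable_const.mul measurable_id).aemeasurable
  have hsum := map_sum_gaussianReal hind hS hlaw (Finset.univ.filter fun i => s i = 1)
  have hSm : Measurable (∑ i with s i = 1, S i) := by
    rw [Finset.sum_fn]
    exact Finset.measurable_sum _ fun i _ => hS i
  have hn0 : 0 < n := hn ▸ Finset.card_pos.2 ⟨v, by simpa using hs.2⟩
  have ha : (0 : ℝ≥0) < n / σ ^ 2 := div_pos (Nat.cast_pos.2 hn0) (pow_pos hσ 2)
  have hQ := gaussianReal_Iio_zero ha
  rw [NNReal.coe_div, NNReal.coe_natCast, NNReal.coe_pow] at hQ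
  have hmean : (n : ℝ) * (2 / (σ : ℝ) ^ 2) = 2 * ((n : ℝ) / (σ : ℝ) ^ 2) := by ring
  have hvar : (n : ℝ≥0) * (4 / σ ^ 2) = 4 * (n / σ ^ 2) := by ring
  rw [hn, hmean, hvar] at hsum
  rw [← hQ, ← hsum, map_measureReal_apply hSm measurableSet_Iio]
  refine hsym.measure_le_bitErrorProb hs x hτ (hSm measurableSet_Iio) ?_ ?_
  · intro y hy
    simp only [Set.mem_preimage, Finset.sum_apply, Set.mem_Iio, S] at hy ⊢
    rw [not_lt]
    have hneg : ∑ i with s i = 1, 2 * signal (x i) / (σ : ℝ) ^ 2 * reflect (fun y => -y) s y i =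
        -∑ i with s i = 1, 2 * signal (x i) / (σ : ℝ) ^ 2 * y i := by
      rw [← Finset.sum_neg_distrib]
      refine Finset.sum_congr rfl fun i hi => ?_
      rw [reflect, if_pos (Finset.mem_filter.1 hi).2, mul_neg]
    linarith
  · intro y hy
    simpa [S] using hy

/-! ### The binary symmetric channel -/

theorem bsc_law_singleton (q : ℝ) (b y : ZMod 2) :
    (bsc q).law b {y} = if y = b then ENNReal.ofReal (1 - q) else ENNReal.ofReal q := by
  rw [BinaryChannel.law, withDensity_apply _ (measurableSet_singleton y)]
  simp [bsc]

theorem measurable_of_zmod_two {α : Type*} [MeasurableSpace α] (f : ZMod 2 → α) : Measurable f :=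
  measurable_from_top

/-- For crossover probability `q > 0`, flipping the output is the symmetry of the channel. An output
equal to the input is evidence `ln ((1 - q) / q)` in favour of it, an output different from it is
evidence of the same size against it. -/
theorem isSymmetric_bsc {q : ℝ} (hq : 0 < q) (hq' : q < 1) :
    IsSymmetric (bsc q) (fun y => y + 1)
      (fun b y => if y = b then Real.log ((1 - q) / q) else -Real.log ((1 - q) / q)) where
  isProbabilityMeasure b := by
    constructor
    rw [← Finset.coe_univ, ← sum_measure_singleton]
    change ∑ y ∈ {0, 1}, (bsc q).law b {y} = 1
    rw [Finset.sum_pair zero_ne_one, bsc_law_singleton, bsc_law_singleton]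
    have hadd : ENNReal.ofReal (1 - q) + ENNReal.ofReal q = 1 := by
      rw [← ENNReal.ofReal_add (by linarith) hq.le, sub_add_cancel, ENNReal.ofReal_one]
    rcases zmod_two_cases b with rfl | rfl
    · simpa using hadd
    · simpa [add_comm] using hadd
  measurable_map := measurable_of_zmod_two _
  measurable_llr := measurable_of_zmod_two _
  measurable_ratio b := measurable_of_zmod_two _
  dens_map b y := by
    change (if y + 1 = b then _ else _) = if y = b + 1 then _ else _
    have h : ∀ y b : ZMod 2, y + 1 = b ↔ y = b + 1 := by decide
    rw [if_congr (h y b) rfl rfl]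
  dens_ne_zero b y := by
    change (if y = b then ENNReal.ofReal (1 - q) else ENNReal.ofReal q) ≠ 0
    split_ifs
    · exact (ENNReal.ofReal_pos.2 (by linarith)).ne'
    · exact (ENNReal.ofReal_pos.2 hq).ne'
  dens_ne_top b y := by
    change (if y = b then ENNReal.ofReal (1 - q) else ENNReal.ofReal q) ≠ ∞
    split_ifs <;> exact ENNReal.ofReal_ne_top
  map_law b := by
    have hq1 : 0 < 1 - q := by linarith
    refine Measure.ext_of_singleton fun y => ?_
    have hpre : (fun y : ZMod 2 => y + 1) ⁻¹' {y} = {y + 1} := by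
      ext z
      have h : ∀ z y : ZMod 2, z + 1 = y ↔ z = y + 1 := by decide
      exact h z y
    rw [Measure.map_apply (measurable_of_zmod_two _) (measurableSet_singleton y), hpre,
      withDensity_apply _ (measurableSet_singleton y), lintegral_singleton, bsc_law_singleton,
      bsc_law_singleton]
    have h : ∀ y b : ZMod 2, y + 1 = b ↔ ¬ y = b := by decide
    by_cases hy : y = b
    · rw [if_neg (by simp [h, hy]), if_pos hy, if_pos hy, ← ENNReal.ofReal_mul (Real.exp_pos _).le,
        Real.exp_neg, Real.exp_log (by positivity)]
      congr 1
      field_simp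
    · rw [if_pos (by simp [h, hy]), if_neg hy, if_neg hy, ← ENNReal.ofReal_mul (Real.exp_pos _).le,
        neg_neg, Real.exp_log (by positivity)]
      congr 1
      field_simp

/-- The probability that the outputs at the positions of `K` lie in given sets, all of the same
probability `r`. -/
theorem wordLaw_pi_ite {Y : Type} [MeasurableSpace Y] {W : BinaryChannel Y}
    [∀ b, IsProbabilityMeasure (W.law b)] {N : ℕ} (x : Fin N → ZMod 2) (K : Finset (Fin N))
    (E : Fin N → Set Y) {r : ℝ} (hr : 0 ≤ r) (hE : ∀ i ∈ K, W.law (x i) (E i) = ENNReal.ofReal r) :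
    (W.wordLaw x).real (Set.univ.pi fun i => if i ∈ K then E i else Set.univ) = r ^ K.card := by
  have h : ∀ i, W.law (x i) (if i ∈ K then E i else Set.univ) =
      if i ∈ K then ENNReal.ofReal r else 1 := by
    intro i
    split_ifs with hi
    · exact hE i hi
    · exact measure_univ
  rw [Measure.real, BinaryChannel.wordLaw, Measure.pi_pi, Finset.prod_congr rfl fun i _ => h i,
    Finset.prod_ite_mem, Finset.univ_inter, Finset.prod_const, ENNReal.toReal_pow,
    ENNReal.toReal_ofReal hr]

/-- The region `U` compared with the decision is a wrong majority among an odd number `2 * k - 1` of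
positions of the support, all of them or all but one. It contains the event that `k` given positions
are wrong. -/
theorem rpow_le_bitErrorProb_bsc {q : ℝ} (hq : 0 < q) (hq' : q ≤ 1 / 2) {M N : ℕ}
    {H : TannerGraph M N} {l : ℕ} {v : Fin N} {s : Fin N → ZMod 2}
    (hs : s ∈ rootOneTreeCode H (2 * l) v) (x : Fin N → ZMod 2) {τ : ℝ} (hτ : 1 / 2 ≤ τ) {n : ℕ}
    (hn : (Finset.univ.filter fun i => s i = 1).card = n) :
    q ^ (((n : ℝ) + 1) / 2) ≤ bitErrorProb (bsc q) τ H l x v := by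
  have hsym := isSymmetric_bsc hq (by linarith : q < 1)
  have := hsym.isProbabilityMeasure
  have hprob : IsProbabilityMeasure ((bsc q).wordLaw x) := by
    unfold BinaryChannel.wordLaw
    infer_instance
  have hn0 : 0 < n := hn ▸ Finset.card_pos.2 ⟨v, by simpa using hs.2⟩
  -- `k` is half of `n`, rounded up.
  obtain ⟨k, hk0, hk1, hk2⟩ : ∃ k, 1 ≤ k ∧ 2 * k ≤ n + 1 ∧ n ≤ 2 * k :=
    ⟨(n + 1) / 2, by omega, by omega, by omega⟩
  set S := Finset.univ.filter fun i => s i = 1 with hS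
  obtain ⟨J, hJS, hJ⟩ := Finset.exists_subset_card_eq (s := S) (n := 2 * k - 1) (by omega)
  obtain ⟨K, hKJ, hK⟩ := Finset.exists_subset_card_eq (s := J) (n := k) (by omega)
  set U : Set (Fin N → ZMod 2) := {y | k ≤ (J.filter fun i => ¬ y i = x i).card} with hU
  have hflip : ∀ a b : ZMod 2, a + 1 ≠ b ↔ a = b := by decide
  -- The event that the positions of `K` are wrong has probability `q ^ k` and lies in `U`.
  have hUle : q ^ k ≤ ((bsc q).wordLaw x).real U := by
    have hbox := wordLaw_pi_ite (W := bsc q) x K (fun i => {x i + 1}) hq.le fun i _ => by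
      rw [bsc_law_singleton, if_neg ((by decide : ∀ b : ZMod 2, b + 1 ≠ b) _)]
    rw [hK] at hbox
    rw [← hbox]
    refine measureReal_mono fun y hy => ?_
    rw [hU, Set.mem_ofPred_eq, ← hK]
    refine Finset.card_le_card fun i hi => Finset.mem_filter.2 ⟨hKJ hi, ?_⟩
    have hyi : y i = x i + 1 := by simpa [hi] using hy i trivial
    rw [hyi]
    exact (by decide : ∀ b : ZMod 2, b + 1 ≠ b) _
  have hexp : q ^ (((n : ℝ) + 1) / 2) ≤ q ^ k := by
    rw [← Real.rpow_natCast]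
    refine Real.rpow_le_rpow_of_exponent_ge hq (by linarith) ?_
    rw [le_div_iff₀ two_pos, mul_comm]
    exact_mod_cast hk1
  refine hexp.trans (hUle.trans (hsym.measure_le_bitErrorProb hs x hτ ?_ ?_ ?_))
  · exact MeasurableSet.of_discrete
  · -- Reflection exchanges right and wrong in `J`, and both cannot reach `k` among `2 * k - 1`.
    intro y hy hy'
    have hcard := Finset.card_filter_add_card_filter_not (s := J) fun i => y i = x i
    have hrefl : (J.filter fun i => ¬ reflect (fun b : ZMod 2 => b + 1) s y i = x i) =
        J.filter fun i => y i = x i := by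
      refine Finset.filter_congr fun i hi => ?_
      rw [reflect, if_pos (Finset.mem_filter.1 (hJS hi)).2]
      exact hflip _ _
    rw [hU, Set.mem_ofPred_eq] at hy hy'
    rw [hrefl] at hy'
    omega
  · -- Outside `U` at most `n - k`, hence at most half, of the positions of the support are wrong.
    intro y hy
    rw [hU, Set.mem_ofPred_eq, not_le] at hy
    have hcard := Finset.card_filter_add_card_filter_not (s := S) fun i => y i = x i
    have hsplit : (S.filter fun i => ¬ y i = x i).card ≤
        (J.filter fun i => ¬ y i = x i).card + (S \ J).card := by
      rw [← Finset.sdiff_union_of_subset hJS, Finset.filter_union, add_comm,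
        Finset.sdiff_union_of_subset hJS]
      exact (Finset.card_union_le _ _).trans
        (add_le_add_left (Finset.card_le_card (Finset.filter_subset _ _)) _)
    rw [Finset.card_sdiff_of_subset hJS] at hsplit
    have hle : ((S.filter fun i => ¬ y i = x i).card : ℝ) ≤
        (S.filter fun i => y i = x i).card := by
      norm_cast
      omega
    have hlog : 0 ≤ Real.log ((1 - q) / q) :=
      Real.log_nonneg ((one_le_div₀ hq).2 (by linarith))
    rw [Finset.sum_ite, Finset.sum_const, Finset.sum_const, nsmul_eq_mul, nsmul_eq_mul]
    nlinarith

/-! ### The erasure channel -/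

instance : MeasurableSingletonClass ErasedBit := ⟨fun _ => trivial⟩

instance : Fintype ErasedBit := inferInstanceAs (Fintype (Option (ZMod 2)))

theorem bec_law_singleton (ε : ℝ) (b : ZMod 2) (y : ErasedBit) :
    (bec ε).law b {y} = becProb ε b y := by
  rw [BinaryChannel.law, withDensity_apply _ (measurableSet_singleton y)]
  simp only [bec, Measure.restrict_singleton, Measure.count_singleton, one_smul]
  exact lintegral_dirac y (becProb ε b)

theorem isProbabilityMeasure_bec_law {ε : ℝ} (hε : 0 ≤ ε) (hε' : ε ≤ 1) (b : ZMod 2) :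
    IsProbabilityMeasure ((bec ε).law b) := by
  constructor
  have hsum : (bec ε).law b Set.univ = ∑ y : Option (ZMod 2), becProb ε b y := by
    rw [← Finset.coe_univ, ← sum_measure_singleton]
    exact Finset.sum_congr rfl fun y _ => bec_law_singleton ε b y
  rw [hsum, Fintype.sum_option]
  simp only [becProb, Finset.sum_ite_eq', Finset.mem_univ, if_true]
  rw [← ENNReal.ofReal_add hε (by linarith), add_sub_cancel, ENNReal.ofReal_one]

/-- The output of the channel for an erased bit. -/
def erasure : ErasedBit := (none : Option (ZMod 2))

theorem llr_bec_none {ε : ℝ} (hε : 0 < ε) : (bec ε).llr erasure = 0 := by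
  change ENNReal.log (ENNReal.ofReal ε / ENNReal.ofReal ε) = 0
  rw [ENNReal.div_self (ENNReal.ofReal_pos.2 hε).ne' ENNReal.ofReal_ne_top, ENNReal.log_one]

theorem pow_le_bitErrorProb_bec {ε : ℝ} (hε : 0 < ε) (hε' : ε ≤ 1) {M N : ℕ}
    {H : TannerGraph M N} {l : ℕ} {v : Fin N} {s : Fin N → ZMod 2}
    (hs : s ∈ rootOneTreeCode H (2 * l) v) (x : Fin N → ZMod 2) {n : ℕ}
    (hn : (Finset.univ.filter fun i => s i = 1).card = n) :
    ε ^ n ≤ bitErrorProb (bec ε) 1 H l x v := by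
  have := isProbabilityMeasure_bec_law hε.le hε'
  have hprob : IsProbabilityMeasure ((bec ε).wordLaw x) := by
    unfold BinaryChannel.wordLaw
    infer_instance
  have hbox := wordLaw_pi_ite (W := bec ε) x (Finset.univ.filter fun i => s i = 1)
    (fun _ => {erasure}) hε.le fun i _ => bec_law_singleton ε (x i) erasure
  rw [hn] at hbox
  rw [bitErrorProb, one_mul, ← hbox]
  refine le_add_of_nonneg_of_le measureReal_nonneg (measureReal_mono fun y hy => ?_)
  refine bpOutput_eq_zero hs fun i hi => ?_
  have hyi : y i = erasure := by simpa [hi] using hy i trivial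
  rw [hyi, llr_bec_none hε]

/-! ### Convexity of the bounds in the weight -/

theorem hasDerivAt_gaussQ (x : ℝ) :
    HasDerivAt gaussQ (-(1 / √(2 * Real.pi) * Real.exp (-x ^ 2 / 2))) x := by
  have hcont : Continuous fun t : ℝ => 1 / √(2 * Real.pi) * Real.exp (-t ^ 2 / 2) := by fun_prop
  have hint : Integrable fun t : ℝ => 1 / √(2 * Real.pi) * Real.exp (-t ^ 2 / 2) := by
    simpa [ProbabilityTheory.gaussianPDFReal_def] using
      ProbabilityTheory.integrable_gaussianPDFReal 0 1
  have heq : gaussQ = fun x => gaussQ 0 -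
      ∫ t in (0 : ℝ)..x, 1 / √(2 * Real.pi) * Real.exp (-t ^ 2 / 2) := by
    ext x
    rw [← intervalIntegral.integral_Ioi_sub_Ioi' hint.integrableOn hint.integrableOn, gaussQ,
      gaussQ, sub_sub_cancel]
  rw [heq]
  exact (intervalIntegral.integral_hasDerivAt_right (hcont.intervalIntegrable _ _)
    (hcont.stronglyMeasurableAtFilter _ _) hcont.continuousAt).const_sub _

/-- The derivative `-exp (-u / 2) / (2 * √(2 * π * u))` is increasing. -/
theorem convexOn_gaussQ_sqrt : ConvexOn ℝ (Set.Ici 0) fun u => gaussQ √u := by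
  have hcont : Continuous gaussQ :=
    continuous_iff_continuousAt.2 fun x => (hasDerivAt_gaussQ x).continuousAt
  have hderiv : ∀ u : ℝ, 0 < u → HasDerivAt (fun u => gaussQ √u)
      (-(1 / √(2 * Real.pi) * Real.exp (-√u ^ 2 / 2)) * (1 / (2 * √u))) u := fun u hu =>
    (hasDerivAt_gaussQ √u).comp u (Real.hasDerivAt_sqrt hu.ne')
  refine MonotoneOn.convexOn_of_deriv (convex_Ici 0)
    (hcont.comp Real.continuous_sqrt).continuousOn ?_ ?_
  · rw [interior_Ici]
    exact fun u hu => (hderiv u hu).differentiableAt.differentiableWithinAt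
  · rw [interior_Ici]
    intro u (hu : 0 < u) u' (hu' : 0 < u') h
    rw [(hderiv u hu).deriv, (hderiv u' hu').deriv, neg_mul, neg_mul, neg_le_neg_iff,
      Real.sq_sqrt hu.le, Real.sq_sqrt hu'.le]
    have := Real.sqrt_pos.2 hu
    gcongr

theorem convexOn_gaussQ_sqrt_div (a : ℝ) (ha : 0 ≤ a) :
    ConvexOn ℝ (Set.Ici 0) fun u => gaussQ √(u / a) := by
  have h := convexOn_gaussQ_sqrt.comp_linearMap (a⁻¹ • LinearMap.id : ℝ →ₗ[ℝ] ℝ)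
  refine (h.subset (fun u (hu : 0 ≤ u) => ?_) (convex_Ici 0)).congr fun u _ => ?_
  · exact mul_nonneg (inv_nonneg.2 ha) hu
  · simp [div_eq_inv_mul]

theorem convexOn_rpow_add_one_div_two {q : ℝ} (hq : 0 < q) :
    ConvexOn ℝ Set.univ fun u : ℝ => q ^ ((u + 1) / 2) := by
  have hsqrt := Real.rpow_pos_of_pos hq (1 / 2)
  refine ((convexOn_rpow_left hsqrt).smul hsqrt.le).congr fun u _ => ?_
  simp only [smul_eq_mul]
  rw [← Real.rpow_mul hq.le, ← Real.rpow_add hq]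
  ring_nf

/-! ### Averaging over the ensemble -/

theorem hammingNorm_eq_card {N : ℕ} (s : Fin N → ZMod 2) :
    hammingNorm s = (Finset.univ.filter fun i => s i = 1).card := by
  rw [hammingNorm]
  congr 1
  refine Finset.filter_congr fun i _ => ?_
  exact (by decide : ∀ b : ZMod 2, b ≠ 0 ↔ b = 1) _

theorem exists_hammingNorm_eq_minWeight {M N : ℕ} {H : TannerGraph M N} {k : ℕ} {v : Fin N}
    (h : minWeight H k v ≠ ⊤) :
    ∃ s ∈ rootOneTreeCode H k v, (hammingNorm s : ℕ∞) = minWeight H k v := by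
  have hne : (rootOneTreeCode H k v).Nonempty := by
    by_contra hempty
    rw [Set.not_nonempty_iff_eq_empty] at hempty
    exact h (by simp [minWeight, hempty])
  have hmem := csInf_mem (hne.image fun s => (hammingNorm s : ℕ∞))
  rw [sInf_image] at hmem
  exact hmem

/-- A convex lower bound for the bit error probability in terms of the minimum weight extends to
averages, by Jensen's inequality. -/
theorem le_averageBER {Y : Type} [MeasurableSpace Y] (W : BinaryChannel Y) (τ : ℝ) {N l : ℕ}
    (hN : 0 < N) {L R : ℝ[X]} (hne : (ensemble N L R).Nonempty)
    (src : ∀ H : TannerGraph (numChecks N L R) N, PMF {x // x ∈ code H}) {w : ℝ≥0}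
    (hw : expectedMinWeight N L R (2 * l) = (w : ℝ≥0∞)) {f : ℝ → ℝ}
    (hf : ConvexOn ℝ (Set.Ici 0) f)
    (h : ∀ (H : TannerGraph (numChecks N L R) N) (v : Fin N) (s : Fin N → ZMod 2),
      s ∈ rootOneTreeCode H (2 * l) v → ∀ x : Fin N → ZMod 2,
        f (hammingNorm s) ≤ bitErrorProb W τ H l x v) :
    f w ≤ averageBER W τ N L R src l := by
  have hc : (0 : ℝ) < (ensemble N L R).card := Nat.cast_pos.2 hne.card_pos
  have hN' : (0 : ℝ) < N := Nat.cast_pos.2 hN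
  have hsum : ∑ H ∈ ensemble N L R, ∑ v : Fin N, (minWeight H (2 * l) v : ℝ≥0∞) ≠ ∞ := by
    intro htop
    rw [expectedMinWeight, htop, ENNReal.top_div_of_ne_top
      (ENNReal.mul_ne_top (ENNReal.natCast_ne_top _) (ENNReal.natCast_ne_top _))] at hw
    exact ENNReal.coe_ne_top hw.symm
  have hfin : ∀ H ∈ ensemble N L R, ∀ v : Fin N, minWeight H (2 * l) v ≠ ⊤ := by
    intro H hH v htop
    rw [ENNReal.sum_ne_top] at hsum
    have := ENNReal.sum_ne_top.1 (hsum H hH) v (Finset.mem_univ v)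
    rw [htop] at this
    exact this rfl
  have hex : ∀ (H : TannerGraph (numChecks N L R) N) (v : Fin N), ∃ n : ℕ, H ∈ ensemble N L R →
      (minWeight H (2 * l) v = n ∧ ∀ x : Fin N → ZMod 2, f n ≤ bitErrorProb W τ H l x v) := by
    intro H v
    by_cases hH : H ∈ ensemble N L R
    · obtain ⟨s, hs, hs'⟩ := exists_hammingNorm_eq_minWeight (hfin H hH v)
      exact ⟨hammingNorm s, fun _ => ⟨hs'.symm, h H v s hs⟩⟩
    · exact ⟨0, fun hH' => absurd hH' hH⟩
  choose n hn using hex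
  have hwn : (w : ℝ) = ∑ p ∈ ensemble N L R ×ˢ (Finset.univ : Finset (Fin N)),
      (((ensemble N L R).card : ℝ) * N)⁻¹ * (n p.1 p.2 : ℝ) := by
    have hnum : ∑ H ∈ ensemble N L R, ∑ v : Fin N, (minWeight H (2 * l) v : ℝ≥0∞) =
        ((∑ H ∈ ensemble N L R, ∑ v : Fin N, n H v : ℕ) : ℝ≥0∞) := by
      rw [Nat.cast_sum]
      refine Finset.sum_congr rfl fun H hH => ?_
      rw [Nat.cast_sum]
      refine Finset.sum_congr rfl fun v _ => ?_
      rw [(hn H v hH).1]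
      simp
    rw [expectedMinWeight, hnum] at hw
    have hreal := congrArg ENNReal.toReal hw
    simp only [ENNReal.toReal_div, ENNReal.toReal_mul, ENNReal.toReal_natCast,
      ENNReal.coe_toReal] at hreal
    rw [← hreal, ← Finset.mul_sum, Finset.sum_product, div_eq_inv_mul]
    push_cast
    rfl
  have hcard : ∑ _p ∈ ensemble N L R ×ˢ (Finset.univ : Finset (Fin N)),
      (((ensemble N L R).card : ℝ) * N)⁻¹ = 1 := by
    rw [Finset.sum_const, Finset.card_product, Finset.card_univ, Fintype.card_fin, nsmul_eq_mul,
      Nat.cast_mul, mul_inv_cancel₀ (mul_pos hc hN').ne']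
  have hjensen := hf.map_sum_le (t := ensemble N L R ×ˢ (Finset.univ : Finset (Fin N)))
    (w := fun _ => (((ensemble N L R).card : ℝ) * N)⁻¹) (p := fun p => (n p.1 p.2 : ℝ))
    (fun _ _ => (inv_pos.2 (mul_pos hc hN')).le) hcard fun _ _ => Set.mem_Ici.2 (Nat.cast_nonneg _)
  simp only [smul_eq_mul] at hjensen
  rw [← hwn] at hjensen
  refine hjensen.trans ?_
  rw [← Finset.mul_sum, Finset.sum_product, averageBER, mul_inv, mul_assoc, inv_mul_eq_div,
    Finset.mul_sum]
  refine div_le_div_of_nonneg_right (Finset.sum_le_sum fun H hH => ?_) hc.le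
  have hsrc : ∑ x : {x // x ∈ code H}, (src H x).toReal = 1 := by
    rw [← ENNReal.toReal_sum fun x _ => (src H).apply_ne_top x,
      ← tsum_fintype (L := .unconditional _), PMF.tsum_coe,
      ENNReal.toReal_one]
  calc (N : ℝ)⁻¹ * ∑ v : Fin N, f (n H v)
      = ∑ x : {x // x ∈ code H}, (src H x).toReal * ((∑ v : Fin N, f (n H v)) / N) := by
        rw [← Finset.sum_mul, hsrc, one_mul, inv_mul_eq_div]
    _ ≤ _ := by
        refine Finset.sum_le_sum fun x _ => mul_le_mul_of_nonneg_left ?_ ENNReal.toReal_nonneg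
        exact div_le_div_of_nonneg_right
          (Finset.sum_le_sum fun v _ => (hn H v hH).2 x.1) hN'.le

theorem averageBER_nonneg {Y : Type} [MeasurableSpace Y] (W : BinaryChannel Y) {τ : ℝ}
    (hτ : 0 ≤ τ) (N l : ℕ) (L R : ℝ[X])
    (src : ∀ H : TannerGraph (numChecks N L R) N, PMF {x // x ∈ code H}) :
    0 ≤ averageBER W τ N L R src l :=
  div_nonneg (Finset.sum_nonneg fun _ _ => Finset.sum_nonneg fun _ _ =>
    mul_nonneg ENNReal.toReal_nonneg (div_nonneg (Finset.sum_nonneg fun _ _ =>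
      add_nonneg measureReal_nonneg (mul_nonneg hτ measureReal_nonneg)) (Nat.cast_nonneg _)))
    (Nat.cast_nonneg _)

/-- The root belongs to the support of every word of the root-constrained tree code, so that the
minimum weight is positive. -/
theorem one_le_minWeight {M N : ℕ} (H : TannerGraph M N) (k : ℕ) (v : Fin N) :
    1 ≤ minWeight H k v := by
  refine le_iInf₂ fun s hs => ?_
  have hne : s ≠ 0 := fun h => by
    have := hs.2
    rw [h] at this
    exact zero_ne_one this
  exact_mod_cast Nat.one_le_iff_ne_zero.2 (hammingNorm_ne_zero_iff.2 hne)

theorem expectedMinWeight_ne_zero {N : ℕ} (hN : 0 < N) {L R : ℝ[X]}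
    (hne : (ensemble N L R).Nonempty) (k : ℕ) : expectedMinWeight N L R k ≠ 0 := by
  obtain ⟨H, hH⟩ := hne
  rw [expectedMinWeight, ne_eq, ENNReal.div_eq_zero_iff, not_or]
  refine ⟨fun h0 => ?_,
    ENNReal.mul_ne_top (ENNReal.natCast_ne_top _) (ENNReal.natCast_ne_top _)⟩
  have h1 := Finset.sum_eq_zero_iff.1 (Finset.sum_eq_zero_iff.1 h0 H hH) ⟨0, hN⟩ (Finset.mem_univ _)
  have h2 := one_le_minWeight H k ⟨0, hN⟩
  simp only [ENat.toENNReal_eq_zero] at h1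
  rw [h1] at h2
  simp at h2

end LDPC

theorem theorem1 (N l : ℕ) (hN : 0 < N) (L R : ℝ[X])
    (hL : LDPC.IsDegreeDistribution L) (hR : LDPC.IsDegreeDistribution R)
    (hne : (LDPC.ensemble N L R).Nonempty)
    (src : ∀ H : LDPC.TannerGraph (LDPC.numChecks N L R) N, PMF {x // x ∈ LDPC.code H})
    (w : ℝ≥0) (hw : LDPC.expectedMinWeight N L R (2 * l) = (w : ℝ≥0∞)) :
    (∀ σ : ℝ≥0, 0 < σ → ∀ τ ∈ Set.Icc (1 / 2 : ℝ) 1,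
      LDPC.gaussQ (√((w : ℝ) / (σ : ℝ) ^ 2))
        ≤ LDPC.averageBER (LDPC.biAWGN σ) τ N L R src l) ∧
    (∀ q : ℝ, 0 ≤ q → q ≤ 1 / 2 → ∀ τ ∈ Set.Icc (1 / 2 : ℝ) 1,
      q ^ (((w : ℝ) + 1) / 2) ≤ LDPC.averageBER (LDPC.bsc q) τ N L R src l) ∧
    (∀ ε : ℝ, 0 ≤ ε → ε ≤ 1 →
      ε ^ (w : ℝ) ≤ LDPC.averageBER (LDPC.bec ε) 1 N L R src l) := by
  refine ⟨fun σ hσ τ hτ => ?_, fun q hq hq' τ hτ => ?_, fun ε hε hε' => ?_⟩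
  · exact LDPC.le_averageBER _ τ hN hne src hw
      (LDPC.convexOn_gaussQ_sqrt_div ((σ : ℝ) ^ 2) (sq_nonneg _)) fun H v s hs x =>
        LDPC.gaussQ_le_bitErrorProb hσ hs x hτ.1 (LDPC.hammingNorm_eq_card s).symm
  · rcases hq.eq_or_lt with rfl | hq
    · rw [Real.zero_rpow (by positivity)]
      exact LDPC.averageBER_nonneg _ (by linarith [hτ.1]) N l L R src
    · exact LDPC.le_averageBER _ τ hN hne src hw
        ((LDPC.convexOn_rpow_add_one_div_two hq).subset (Set.subset_univ _) (convex_Ici 0))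
        fun H v s hs x =>
          LDPC.rpow_le_bitErrorProb_bsc hq hq' hs x hτ.1 (LDPC.hammingNorm_eq_card s).symm
  · rcases hε.eq_or_lt with rfl | hε
    · have hw0 : (w : ℝ) ≠ 0 := by
        have := LDPC.expectedMinWeight_ne_zero hN hne (2 * l)
        rw [hw] at this
        exact_mod_cast this
      rw [Real.zero_rpow hw0]
      exact LDPC.averageBER_nonneg _ zero_le_one N l L R src
    · refine LDPC.le_averageBER _ 1 hN hne src hw
        ((convexOn_rpow_left hε).subset (Set.subset_univ _) (convex_Ici 0)) fun H v s hs x => ?_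
      rw [Real.rpow_natCast]
      exact LDPC.pow_le_bitErrorProb_bec hε hε' hs x (LDPC.hammingNorm_eq_card s).symm
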